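/- Let $M$ be an $n$-dimensional real manifold of class $C^2$, and let $T^{p,q}_x(M)$ denote the space of tensors of type $(p,q)$ at $x\in M$. A flat linear transport $L$ over $M$ assigns to all $x,y\in M$ linear maps $L_{x\to y}:T^{p,q}_x(M)\to T^{p,q}_y(M)$ (for all $p,q\ge 0$) such that $L_{x\to y}(A\otimes B)=L_{x\to y}A\otimes L_{x\to y}B$, $L_{x\to y}$ commutes with all contractions, $L_{y\to z}\circ L_{x\to y}=L_{x\to z}$ and $L_{x\to x}=\mathrm{id}$. In a field of bases $\{E_i(x)\}$ of the tangent spaces $T_x(M)$ it is described by the matrix $\mathbf H(y,x)=[H^i_{\ j}(y,x)]$ defined by $L_{x\to y}(E_j(x))=\sum_i H^i_{\ j}(y,x)E_i(y)$. Suppose that $L$ is of class $C^1$, i.e. in local coordinates the components $H^i_{\ j}(y,x)$ are $C^1$ functions of $(y,x)$. The connection generated by $L$ is $$(\nabla^L_V S)(x)=\lim_{\varepsilon\to 0}\frac{1}{\varepsilon}\bigl(L_{x_\varepsilon\to x}S(x_\varepsilon)-S(x)\bigr),$$ for $C^1$ tensor fields $S$, where in local coordinates near $x$ the point $x_\varepsilon$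 has coordinates $x^i+\varepsilon V^i|_x$; its torsion is ${}^LT(A,B)=\nabla^L_AB-\nabla^L_BA-[A,B]$ for $C^1$ vector fields $A,B$ (possibly defined only locally). Corollary 4.1: The following are equivalent. (a) The torsion ${}^LT$ vanishes. (b) There is a field of local holonomic bases on $M$ in which the matrix describing $L$ is constant, that is, there are bases $\{E_i(x)\}$ of $T_x(M)$, $x\in M$, which near each point of $M$ coincide with the basis $\{\partial/\partial x^i\}$ associated to some ($C^2$) local coordinates, and for which $\mathbf H(y,x)$ does not depend on $(x,y)\in M\times M$. (c) Around each point of $M$ there are ($C^2$) local coordinates, with some domain $U$, such that in the associated basis $\{\partial/\partial x^i\}$ the matrix $\mathbf H(y,x)$ does not depend on $(x,y)\in U\times U$. -/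

import Mathlib

open Topology
open scoped Manifold

noncomputable section

/-! ## Tensor algebra of a finite-dimensional real vector space -/

section Tensors

variable (V : Type*) [AddCommGroup V] [Module ℝ V]

/-- Tensors of type `(p, q)` over `V`: multilinear forms in `p` covectors and `q` vectors. -/
abbrev TensorSpace (p q : ℕ) : Type _ :=
  MultilinearMap ℝ (fun _ : Fin p => Module.Dual ℝ V) (MultilinearMap ℝ (fun _ : Fin q => V) ℝ)

/-- The topology of convergence of all components. For finite-dimensional `V` it is the unique
Hausdorff vector space topology. -/
instance TensorSpace.instTopologicalSpace (p q : ℕ) : TopologicalSpace (TensorSpace V p q) :=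
  TopologicalSpace.induced
    (fun (A : TensorSpace V p q) (α : Fin p → Module.Dual ℝ V) (v : Fin q → V) => A α v)
    inferInstance

variable {V}

/-- The tensor product `(A ⊗ B)(α, α'; v, v') = A(α; v) B(α'; v')` of tensors of types `(p, q)`
and `(p', q')`. -/
def TensorSpace.tprod {p q p' q' : ℕ} (A : TensorSpace V p q) (B : TensorSpace V p' q') :
    TensorSpace V (p + p') (q + q') :=
  MultilinearMap.mk'
    (fun α => MultilinearMap.mk'
      (fun v => A (fun i => α (Fin.castAdd p' i)) (fun j => v (Fin.castAdd q' j)) *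
        B (fun i => α (Fin.natAdd p i)) (fun j => v (Fin.natAdd q j)))
      (fun v j x y => by
        induction j using Fin.addCases with
        | left j =>
          have h : ∀ z : V, (fun k => Function.update v (Fin.castAdd q' j) z (Fin.castAdd q' k)) =
              Function.update (fun k => v (Fin.castAdd q' k)) j z := fun z =>
            Function.update_comp_eq_of_injective v (Fin.castAdd_injective q q') j z
          have h' : ∀ z : V, (fun k => Function.update v (Fin.castAdd q' j) z (Fin.natAdd q k)) =
              fun k => v (Fin.natAdd q k) := fun z => by
            funext k
            exact Function.update_of_ne (by simp [Fin.ext_iff]; omega) _ _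
          simp only [h, h', MultilinearMap.map_update_add, add_mul]
        | right j =>
          have h : ∀ z : V, (fun k => Function.update v (Fin.natAdd q j) z (Fin.natAdd q k)) =
              Function.update (fun k => v (Fin.natAdd q k)) j z := fun z =>
            Function.update_comp_eq_of_injective v (Fin.natAdd_injective q' q) j z
          have h' : ∀ z : V, (fun k => Function.update v (Fin.natAdd q j) z (Fin.castAdd q' k)) =
              fun k => v (Fin.castAdd q' k) := fun z => by
            funext k
            exact Function.update_of_ne (by simp [Fin.ext_iff]; omega) _ _
          simp only [h, h', MultilinearMap.map_update_add, mul_add])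
      (fun v j c x => by
        induction j using Fin.addCases with
        | left j =>
          have h : ∀ z : V, (fun k => Function.update v (Fin.castAdd q' j) z (Fin.castAdd q' k)) =
              Function.update (fun k => v (Fin.castAdd q' k)) j z := fun z =>
            Function.update_comp_eq_of_injective v (Fin.castAdd_injective q q') j z
          have h' : ∀ z : V, (fun k => Function.update v (Fin.castAdd q' j) z (Fin.natAdd q k)) =
              fun k => v (Fin.natAdd q k) := fun z => by
            funext k
            exact Function.update_of_ne (by simp [Fin.ext_iff]; omega) _ _
          simp only [h, h', MultilinearMap.map_update_smul, smul_mul_assoc]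
        | right j =>
          have h : ∀ z : V, (fun k => Function.update v (Fin.natAdd q j) z (Fin.natAdd q k)) =
              Function.update (fun k => v (Fin.natAdd q k)) j z := fun z =>
            Function.update_comp_eq_of_injective v (Fin.natAdd_injective q' q) j z
          have h' : ∀ z : V, (fun k => Function.update v (Fin.natAdd q j) z (Fin.castAdd q' k)) =
              fun k => v (Fin.castAdd q' k) := fun z => by
            funext k
            exact Function.update_of_ne (by simp [Fin.ext_iff]; omega) _ _
          simp only [h, h', MultilinearMap.map_update_smul, mul_smul_comm]))
    (fun α j x y => by
      ext v
      induction j using Fin.addCases with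
      | left j =>
        have h : ∀ z : Module.Dual ℝ V,
            (fun k => Function.update α (Fin.castAdd p' j) z (Fin.castAdd p' k)) =
            Function.update (fun k => α (Fin.castAdd p' k)) j z := fun z =>
          Function.update_comp_eq_of_injective α (Fin.castAdd_injective p p') j z
        have h' : ∀ z : Module.Dual ℝ V,
            (fun k => Function.update α (Fin.castAdd p' j) z (Fin.natAdd p k)) =
            fun k => α (Fin.natAdd p k) := fun z => by
          funext k
          exact Function.update_of_ne (by simp [Fin.ext_iff]; omega) _ _
        simp [h, h', add_mul]
      | right j =>
        have h : ∀ z : Module.Dual ℝ V,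
            (fun k => Function.update α (Fin.natAdd p j) z (Fin.natAdd p k)) =
            Function.update (fun k => α (Fin.natAdd p k)) j z := fun z =>
          Function.update_comp_eq_of_injective α (Fin.natAdd_injective p' p) j z
        have h' : ∀ z : Module.Dual ℝ V,
            (fun k => Function.update α (Fin.natAdd p j) z (Fin.castAdd p' k)) =
            fun k => α (Fin.castAdd p' k) := fun z => by
          funext k
          exact Function.update_of_ne (by simp [Fin.ext_iff]; omega) _ _
        simp [h, h', mul_add])
    (fun α j c x => by
      ext v
      induction j using Fin.addCases with
      | left j =>
        have h : ∀ z : Module.Dual ℝ V,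
            (fun k => Function.update α (Fin.castAdd p' j) z (Fin.castAdd p' k)) =
            Function.update (fun k => α (Fin.castAdd p' k)) j z := fun z =>
          Function.update_comp_eq_of_injective α (Fin.castAdd_injective p p') j z
        have h' : ∀ z : Module.Dual ℝ V,
            (fun k => Function.update α (Fin.castAdd p' j) z (Fin.natAdd p k)) =
            fun k => α (Fin.natAdd p k) := fun z => by
          funext k
          exact Function.update_of_ne (by simp [Fin.ext_iff]; omega) _ _
        simp [h, h', mul_assoc]
      | right j =>
        have h : ∀ z : Module.Dual ℝ V,
            (fun k => Function.update α (Fin.natAdd p j) z (Fin.natAdd p k)) =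
            Function.update (fun k => α (Fin.natAdd p k)) j z := fun z =>
          Function.update_comp_eq_of_injective α (Fin.natAdd_injective p' p) j z
        have h' : ∀ z : Module.Dual ℝ V,
            (fun k => Function.update α (Fin.natAdd p j) z (Fin.castAdd p' k)) =
            fun k => α (Fin.castAdd p' k) := fun z => by
          funext k
          exact Function.update_of_ne (by simp [Fin.ext_iff]; omega) _ _
        simp [h, h', mul_left_comm])

variable [FiniteDimensional ℝ V]

/-- The contraction of the `a`-th covector slot with the `b`-th vector slot,
`(C A)(α; v) = ∑ i, A(…, eⁱ, …; …, e i, …)`. Here `e` is a basis with dual basis `eⁱ`;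
the sum does not depend on it. -/
def TensorSpace.contract {p q : ℕ} (a : Fin (p + 1)) (b : Fin (q + 1))
    (A : TensorSpace V (p + 1) (q + 1)) : TensorSpace V p q :=
  ∑ i, ((LinearMap.applyₗ (Module.finBasis ℝ V i)).comp
      (MultilinearMap.curryMidLinearEquiv ℝ (fun _ : Fin (q + 1) => V) ℝ b).toLinearMap
    ).compMultilinearMap (A.curryMid a ((Module.finBasis ℝ V).coord i))

theorem TensorSpace.contract_apply {p q : ℕ} (a : Fin (p + 1)) (b : Fin (q + 1))
    (A : TensorSpace V (p + 1) (q + 1)) (α : Fin p → Module.Dual ℝ V) (v : Fin q → V) :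
    TensorSpace.contract a b A α v =
      ∑ i, A (a.insertNth ((Module.finBasis ℝ V).coord i) α)
        (b.insertNth (Module.finBasis ℝ V i) v) := by
  simp [TensorSpace.contract]

variable (V) in
/-- The identification of vectors with tensors of type `(1, 0)`, `v ↦ (α ↦ α v)`. -/
def TensorSpace.ofVec : V ≃ₗ[ℝ] TensorSpace V 1 0 :=
  (Module.evalEquiv ℝ V).trans
    ((LinearEquiv.congrRight
      (MultilinearMap.constLinearEquivOfIsEmpty ℝ ℝ (fun _ : Fin 0 => V) ℝ)).trans
    (MultilinearMap.ofSubsingletonₗ ℝ ℝ (Module.Dual ℝ V)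
      (MultilinearMap ℝ (fun _ : Fin 0 => V) ℝ) (0 : Fin 1)))

theorem TensorSpace.ofVec_apply (x : V) (α : Fin 1 → Module.Dual ℝ V) (v : Fin 0 → V) :
    TensorSpace.ofVec V x α v = α 0 x := by
  simp [TensorSpace.ofVec, LinearEquiv.congrRight]

end Tensors

/-! ## Flat linear transports -/

section Transports

variable {n : ℕ} {M : Type*} [TopologicalSpace M] [ChartedSpace (EuclideanSpace ℝ (Fin n)) M]

instance TangentSpace.instFiniteDimensionalEuclidean (x : M) :
    FiniteDimensional ℝ (TangentSpace (𝓡 n) x) :=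
  inferInstanceAs (FiniteDimensional ℝ (EuclideanSpace ℝ (Fin n)))

variable (n M) in
/-- A flat linear transport of tensors over the `n`-dimensional manifold `M`: linear maps
`L_{x → y} : T^{p,q}_x(M) → T^{p,q}_y(M)` for all `x`, `y`, `p`, `q`, compatible with tensor
products and with contractions, such that `L_{y → z} ∘ L_{x → y} = L_{x → z}` and
`L_{x → x} = id`. -/
structure FlatLinearTransport where
  map (x y : M) (p q : ℕ) :
    TensorSpace (TangentSpace (𝓡 n) x) p q →ₗ[ℝ] TensorSpace (TangentSpace (𝓡 n) y) p q
  map_tprod (x y : M) {p q p' q' : ℕ} (A : TensorSpace (TangentSpace (𝓡 n) x) p q)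
    (B : TensorSpace (TangentSpace (𝓡 n) x) p' q') :
    map x y (p + p') (q + q') (A.tprod B) = (map x y p q A).tprod (map x y p' q' B)
  map_contract (x y : M) {p q : ℕ} (a : Fin (p + 1)) (b : Fin (q + 1))
    (A : TensorSpace (TangentSpace (𝓡 n) x) (p + 1) (q + 1)) :
    map x y p q (TensorSpace.contract a b A) =
      TensorSpace.contract a b (map x y (p + 1) (q + 1) A)
  map_comp (x y z : M) {p q : ℕ} (A : TensorSpace (TangentSpace (𝓡 n) x) p q) :
    map y z p q (map x y p q A) = map x z p q A
  map_self (x : M) {p q : ℕ} (A : TensorSpace (TangentSpace (𝓡 n) x) p q) : map x x p q A = A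

/-- The `j`-th vector `∂/∂xʲ` at `x` of the basis associated to the local coordinates `c`
(for `x` in the domain of `c`). -/
def coordVec (c : OpenPartialHomeomorph M (EuclideanSpace ℝ (Fin n))) (x : M) (j : Fin n) :
    TangentSpace (𝓡 n) x :=
  (mfderiv (𝓡 n) (𝓡 n) c x).inverse (EuclideanSpace.single j (1 : ℝ))

/-- The `i`-th component `dxⁱ(v)` of a tangent vector `v` at `x` with respect to the local
coordinates `c` (for `x` in the domain of `c`). -/
def coordComp (c : OpenPartialHomeomorph M (EuclideanSpace ℝ (Fin n))) (x : M)
    (v : TangentSpace (𝓡 n) x) (i : Fin n) : ℝ :=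
  (show EuclideanSpace ℝ (Fin n) from mfderiv (𝓡 n) (𝓡 n) c x v) i

namespace FlatLinearTransport

variable (L : FlatLinearTransport n M)

/-- The action of the transport on tangent vectors. -/
def vec (x y : M) : TangentSpace (𝓡 n) x →ₗ[ℝ] TangentSpace (𝓡 n) y :=
  (TensorSpace.ofVec (TangentSpace (𝓡 n) y)).symm.toLinearMap ∘ₗ L.map x y 1 0 ∘ₗ
    (TensorSpace.ofVec (TangentSpace (𝓡 n) x)).toLinearMap

/-- The matrix `H(y, x)` describing the transport in a field `E` of bases,
`L_{x → y} (E_j(x)) = ∑ i, H(y, x)ⁱ_j E_i(y)`. -/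
def matrix (E : (x : M) → Module.Basis (Fin n) ℝ (TangentSpace (𝓡 n) x)) (y x : M) :
    Matrix (Fin n) (Fin n) ℝ :=
  LinearMap.toMatrix (E x) (E y) (L.vec x y)

/-- The matrix of `L_{x → y}` with respect to the coordinate bases of `c` at `x` and of `d` at
`y`; it consists of the components of the bivector `H(y, x)` in these coordinates. -/
def coordMatrix (c d : OpenPartialHomeomorph M (EuclideanSpace ℝ (Fin n))) (y x : M) :
    Matrix (Fin n) (Fin n) ℝ :=
  Matrix.of fun i j => coordComp d y (L.vec x y (coordVec c x j)) i

/-- The transport is of class `C¹`: in all local coordinates of the `C²` manifold `M`, the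
components of the bivector `H(y, x)` are `C¹` functions of `(y, x)`. -/
def IsC1 : Prop :=
  ∀ c ∈ IsManifold.maximalAtlas (𝓡 n) 2 M, ∀ d ∈ IsManifold.maximalAtlas (𝓡 n) 2 M,
    ∀ i j : Fin n,
      ContMDiffOn ((𝓡 n).prod (𝓡 n)) 𝓘(ℝ, ℝ) 1
        (fun z : M × M => L.coordMatrix c d z.1 z.2 i j) (d.source ×ˢ c.source)

/-- The connection generated by the transport: for a vector `v` at `x` and a tensor field `S`,
`∇_v S = lim_{ε → 0} (L_{x_ε → x} S(x_ε) - S(x)) / ε`, where, in local coordinates around `x`,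
the coordinates of `x_ε` are `xⁱ + ε vⁱ`. -/
def covDeriv {p q : ℕ} {x : M} (v : TangentSpace (𝓡 n) x)
    (S : (y : M) → TensorSpace (TangentSpace (𝓡 n) y) p q) :
    TensorSpace (TangentSpace (𝓡 n) x) p q :=
  let c := chartAt (EuclideanSpace ℝ (Fin n)) x
  let w : EuclideanSpace ℝ (Fin n) := mfderiv (𝓡 n) (𝓡 n) c x v
  let γ : ℝ → M := fun ε => c.symm (c x + ε • w)
  Filter.limUnder (𝓝[≠] (0 : ℝ)) fun ε => ε⁻¹ • (L.map (γ ε) x p q (S (γ ε)) - S x)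

/-- The connection generated by the transport, acting on vector fields. -/
def covDerivVec {x : M} (v : TangentSpace (𝓡 n) x) (B : (y : M) → TangentSpace (𝓡 n) y) :
    TangentSpace (𝓡 n) x :=
  (TensorSpace.ofVec (TangentSpace (𝓡 n) x)).symm
    (L.covDeriv v fun y => TensorSpace.ofVec (TangentSpace (𝓡 n) y) (B y))

/-- The torsion `T(A, B) = ∇_A B - ∇_B A - [A, B]` of the connection generated by the
transport. -/
def torsion (A B : (y : M) → TangentSpace (𝓡 n) y) (x : M) : TangentSpace (𝓡 n) x :=
  L.covDerivVec (A x) B - L.covDerivVec (B x) A - VectorField.mlieBracket (𝓡 n) A B x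

/-- The torsion vanishes: `T(A, B)(x) = 0` for all points `x` and all vector fields `A`, `B` that
are `C¹` near `x`. -/
def TorsionVanishes [IsManifold (𝓡 n) 2 M] : Prop :=
  ∀ (A B : (y : M) → TangentSpace (𝓡 n) y) (x : M),
    ContMDiffAt (𝓡 n) (𝓡 n).tangent 1 (fun y => (⟨y, A y⟩ : TangentBundle (𝓡 n) M)) x →
    ContMDiffAt (𝓡 n) (𝓡 n).tangent 1 (fun y => (⟨y, B y⟩ : TangentBundle (𝓡 n) M)) x →
    L.torsion A B x = 0

end FlatLinearTransport

/-- The field `E` of bases is holonomic: around each point it is the basis `∂/∂x¹, …, ∂/∂xⁿ`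
associated to some local coordinates. -/
def IsHolonomic (E : (x : M) → Module.Basis (Fin n) ℝ (TangentSpace (𝓡 n) x)) : Prop :=
  ∀ z : M, ∃ c ∈ IsManifold.maximalAtlas (𝓡 n) 2 M, z ∈ c.source ∧
    ∀ y ∈ c.source, ∀ i, E y i = coordVec c y i

end Transports

end

/-! Fix a point `x₀` and carry a basis of its tangent space to every point of `M`. Since `L_{x → y}
∘ L_{x₀ → x} = L_{x₀ → y}`, the resulting global field of bases is preserved by the transport, so
its matrix is the identity and its members are covariantly constant. On two such members the torsion
reduces to minus their Lie bracket.

If the torsion vanishes, the transported fields therefore commute. In a chart they form a `C¹`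
matrix `A(u)` (`frameRep`), and commutation says that the coframe `A⁻¹` is closed. The Poincaré
lemma gives `f` with `Df = A⁻¹`, and the inverse function theorem makes `f` a `C²` change of
coordinates that turns the frame into `∂/∂xⁱ` (`exists_openPartialHomeomorph_hasFDerivAt_inverse`,
`exists_coordVec_eq_vec`).

Conversely, a constant matrix in coordinates must be the identity, because `L_{x → x} = id`. The
connection then differentiates components, and `∇_A B - ∇_B A` is the coordinate formula for `[A,
B]` (`torsion_eq_zero_of_coordMatrix_eq`). -/

open Topology
open scoped Manifold

noncomputable section

/-! ### Commuting frames and closed coframes in a Banach space. -/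

section VectorSpace

variable {E : Type*} [NormedAddCommGroup E] [NormedSpace ℝ E] [CompleteSpace E]

/-- If the vector fields `u ↦ A u v` commute, then the coframe `u ↦ (A u)⁻¹` is closed. -/
theorem fderiv_inverse_symmetric_of_commute {A : E → E →L[ℝ] E} {u : E}
    (hA : DifferentiableAt ℝ A u) (hinv : ∀ᶠ y in 𝓝 u, (A y).IsInvertible)
    (hcomm : ∀ v w, fderiv ℝ A u (A u v) w = fderiv ℝ A u (A u w) v) (h k : E) :
    fderiv ℝ (fun y => (A y).inverse) u h k = fderiv ℝ (fun y => (A y).inverse) u k h := by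
  have hω : DifferentiableAt ℝ (fun y => (A y).inverse) u :=
    ((hinv.self_of_nhds.contDiffAt_map_inverse (n := 1)).differentiableAt one_ne_zero).comp u hA
  -- Differentiate the identity `A⁻¹ (A v) = v` in the direction `h`.
  have key : ∀ h v, fderiv ℝ (fun y => (A y).inverse) u h (A u v) =
      -(A u).inverse (fderiv ℝ A u h v) := by
    intro h v
    have h1 : HasFDerivAt (fun y => (A y).inverse (A y v)) _ u :=
      hω.hasFDerivAt.clm_apply (hA.hasFDerivAt.clm_apply (hasFDerivAt_const v u))
    have h2 : HasFDerivAt (fun y => (A y).inverse (A y v)) (0 : E →L[ℝ] E) u := by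
      refine (hasFDerivAt_const v u).congr_of_eventuallyEq ?_
      filter_upwards [hinv] with y hy
      exact hy.inverse_apply_self v
    have h3 := DFunLike.congr_fun (h1.unique h2) h
    simp at h3
    rw [eq_neg_iff_add_eq_zero, ← h3]
    abel
  obtain ⟨e, he⟩ := hinv.self_of_nhds
  -- Both arguments are values of `A u`, so `key` applies to each side and commutation identifies
  -- the results.
  obtain ⟨a, rfl⟩ := e.surjective h
  obtain ⟨b, rfl⟩ := e.surjective k
  have hc : ∀ v, e v = A u v := fun v => by rw [← he]; rfl
  rw [hc, hc, key, key, hcomm]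

/-- A `C¹` field of frames whose members commute pairwise is locally the frame of partial
derivatives of some `C²` coordinates. -/
theorem exists_openPartialHomeomorph_hasFDerivAt_inverse {A : E → E →L[ℝ] E} {U : Set E}
    (hU : IsOpen U) (hA : ContDiffOn ℝ 1 A U) (hinv : ∀ u ∈ U, (A u).IsInvertible)
    (hcomm : ∀ u ∈ U, ∀ v w, fderiv ℝ A u (A u v) w = fderiv ℝ A u (A u w) v)
    {a : E} (ha : a ∈ U) :
    ∃ φ : OpenPartialHomeomorph E E, a ∈ φ.source ∧ φ.source ⊆ U ∧
      ContDiffOn ℝ 2 φ φ.source ∧ ContDiffOn ℝ 2 φ.symm φ.target ∧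
      ∀ u ∈ φ.source, HasFDerivAt φ (A u).inverse u := by
  -- The Poincaré lemma is applied on a convex set, hence the ball.
  obtain ⟨r, hr, hrU⟩ := Metric.isOpen_iff.1 hU a ha
  have hωC : ContDiffOn ℝ 1 (fun u => (A u).inverse) (Metric.ball a r) := fun u hu =>
    ((hinv u (hrU hu)).contDiffAt_map_inverse.comp u
      (hA.contDiffAt (hU.mem_nhds (hrU hu)))).contDiffWithinAt
  obtain ⟨f, hf⟩ := (convex_ball a r).exists_forall_hasFDerivAt_of_fderiv_symmetric
    Metric.isOpen_ball (hωC.differentiableOn one_ne_zero) fun u hu =>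
    fderiv_inverse_symmetric_of_commute
      ((hA.contDiffAt (hU.mem_nhds (hrU hu))).differentiableAt one_ne_zero)
      (Filter.eventually_of_mem (hU.mem_nhds (hrU hu)) hinv) (hcomm u (hrU hu))
  have hfC : ContDiffOn ℝ 2 f (Metric.ball a r) := by
    have : (2 : WithTop ℕ∞) = 1 + 1 := by norm_num
    rw [this, contDiffOn_succ_iff_fderiv_of_isOpen Metric.isOpen_ball]
    exact ⟨fun u hu => (hf u hu).differentiableAt.differentiableWithinAt, by simp,
      hωC.congr fun u hu => (hf u hu).fderiv⟩
  have hae : ∀ u ∈ Metric.ball a r, ∃ e : E ≃L[ℝ] E, (e : E →L[ℝ] E) = (A u).inverse := by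
    intro u hu
    obtain ⟨e, he⟩ := hinv u (hrU hu)
    exact ⟨e.symm, by rw [← he, ContinuousLinearMap.inverse_equiv]⟩
  have haB := Metric.mem_ball_self (x := a) hr
  obtain ⟨e, he⟩ := hae a haB
  have hfa : ContDiffAt ℝ 2 f a := hfC.contDiffAt (Metric.isOpen_ball.mem_nhds haB)
  have hfe : HasFDerivAt f (e : E →L[ℝ] E) a := he ▸ hf a haB
  set ψ := hfa.toOpenPartialHomeomorph f hfe two_ne_zero
  have hψ : (ψ : E → E) = f := rfl
  have hsrc : (ψ.restrOpen (Metric.ball a r) Metric.isOpen_ball).source ⊆ Metric.ball a r :=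
    fun u hu => hu.2
  -- The source given by the inverse function theorem may leave the ball, outside which nothing is
  -- known about `f`.
  refine ⟨ψ.restrOpen (Metric.ball a r) Metric.isOpen_ball,
    ⟨hfa.mem_toOpenPartialHomeomorph_source hfe two_ne_zero, haB⟩, hsrc.trans hrU,
    hfC.mono hsrc, ?_, fun u hu => hf u (hsrc hu)⟩
  intro y hy
  have hu := hsrc (OpenPartialHomeomorph.map_target _ hy)
  obtain ⟨e', he'⟩ := hae _ hu
  exact (OpenPartialHomeomorph.contDiffAt_symm (f₀' := e') _ hy (he' ▸ hf _ hu)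
    (hfC.contDiffAt (Metric.isOpen_ball.mem_nhds hu))).contDiffWithinAt

end VectorSpace

/-! ### Topology of the tensor spaces. -/

section Tensors

variable {V : Type*} [AddCommGroup V] [Module ℝ V]

theorem TensorSpace.isEmbedding_coe (p q : ℕ) :
    IsEmbedding (fun (A : TensorSpace V p q) (α : Fin p → Module.Dual ℝ V) (v : Fin q → V) =>
      A α v) where
  eq_induced := rfl
  injective A B h := by
    ext α v
    exact congrFun (congrFun h α) v

/-- Uniqueness of limits lets `limUnder` in `covDeriv` be evaluated from any convergence proof. -/
instance TensorSpace.instT2Space (p q : ℕ) : T2Space (TensorSpace V p q) :=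
  (TensorSpace.isEmbedding_coe p q).t2Space

theorem TensorSpace.continuous_ofVec [FiniteDimensional ℝ V] [TopologicalSpace V]
    [IsTopologicalAddGroup V] [ContinuousSMul ℝ V] [T2Space V] :
    Continuous (TensorSpace.ofVec V) := by
  rw [(TensorSpace.isEmbedding_coe 1 0).continuous_iff]
  refine continuous_pi fun α => continuous_pi fun v => ?_
  simp only [Function.comp_def, TensorSpace.ofVec_apply]
  exact (α 0).continuous_of_finiteDimensional

end Tensors

/-! ### Transport of vectors, and vector fields in coordinates. -/

section Transports

variable {n : ℕ} {M : Type*} [TopologicalSpace M] [ChartedSpace (EuclideanSpace ℝ (Fin n)) M]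

instance TangentSpace.instT2SpaceEuclidean (x : M) : T2Space (TangentSpace (𝓡 n) x) :=
  inferInstanceAs (T2Space (EuclideanSpace ℝ (Fin n)))

namespace FlatLinearTransport

variable (L : FlatLinearTransport n M)

theorem ofVec_vec (x y : M) (v : TangentSpace (𝓡 n) x) :
    TensorSpace.ofVec _ (L.vec x y v) = L.map x y 1 0 (TensorSpace.ofVec _ v) := by
  simp [vec]

theorem vec_comp (x y z : M) (v : TangentSpace (𝓡 n) x) :
    L.vec y z (L.vec x y v) = L.vec x z v := by
  simp [vec, L.map_comp]

theorem vec_self (x : M) (v : TangentSpace (𝓡 n) x) : L.vec x x v = v := by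
  simp [vec, L.map_self]

/-- The transport of tangent vectors as a linear equivalence. -/
def vecEquiv (x y : M) : TangentSpace (𝓡 n) x ≃ₗ[ℝ] TangentSpace (𝓡 n) y :=
  .ofLinearMap (L.vec x y) (L.vec y x)
    (LinearMap.ext fun v => by simp [vec_comp, vec_self])
    (LinearMap.ext fun v => by simp [vec_comp, vec_self])

/-- The curve `ε ↦ x_ε` whose coordinates in the preferred chart at `x` are `xⁱ + ε vⁱ`. -/
def chartLine {x : M} (v : TangentSpace (𝓡 n) x) (ε : ℝ) : M :=
  (chartAt (EuclideanSpace ℝ (Fin n)) x).symm (chartAt (EuclideanSpace ℝ (Fin n)) x x +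
    ε • (show EuclideanSpace ℝ (Fin n) from
      mfderiv (𝓡 n) (𝓡 n) (chartAt (EuclideanSpace ℝ (Fin n)) x) x v))

/-- The identification `ofVec` is continuous, linear and intertwines `vec` with `map`, so a limit of
difference quotients of vectors is also the limit in type `(1, 0)` tensors. -/
theorem covDerivVec_eq_of_tendsto {x : M} {v w : TangentSpace (𝓡 n) x}
    {B : (y : M) → TangentSpace (𝓡 n) y}
    (h : Filter.Tendsto (fun ε : ℝ => ε⁻¹ •
      (L.vec (chartLine v ε) x (B (chartLine v ε)) - B x)) (𝓝[≠] 0) (𝓝 w)) :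
    L.covDerivVec v B = w := by
  rw [covDerivVec, LinearEquiv.symm_apply_eq]
  refine Filter.Tendsto.limUnder_eq ?_
  refine ((TensorSpace.continuous_ofVec.tendsto w).comp h).congr fun ε => ?_
  simp only [Function.comp_apply, map_smul, map_sub, ofVec_vec]
  rfl

/-- Fields which the transport preserves are covariantly constant. -/
theorem covDerivVec_vec (x₀ : M) (e : TangentSpace (𝓡 n) x₀) {x : M} (v : TangentSpace (𝓡 n) x) :
    L.covDerivVec v (fun y => L.vec x₀ y e) = 0 :=
  L.covDerivVec_eq_of_tendsto (by simp [vec_comp])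

end FlatLinearTransport

/-! ### Coordinate representation of vector fields -/

/-- The representation of a vector field in the local coordinates `c`. -/
def coordRep (c : OpenPartialHomeomorph M (EuclideanSpace ℝ (Fin n)))
    (A : (y : M) → TangentSpace (𝓡 n) y) (u : EuclideanSpace ℝ (Fin n)) :
    EuclideanSpace ℝ (Fin n) :=
  mfderiv (𝓡 n) (𝓡 n) c (c.symm u) (A (c.symm u))

variable {c : OpenPartialHomeomorph M (EuclideanSpace ℝ (Fin n))}

theorem mdifferentiable_of_mem_maximalAtlas_two (hc : c ∈ IsManifold.maximalAtlas (𝓡 n) 2 M) :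
    c.MDifferentiable (𝓡 n) (𝓡 n) :=
  ⟨(contMDiffOn_of_mem_maximalAtlas hc).mdifferentiableOn two_ne_zero,
    (contMDiffOn_symm_of_mem_maximalAtlas hc).mdifferentiableOn two_ne_zero⟩

theorem isInvertible_mfderiv_of_mem_maximalAtlas (hc : c ∈ IsManifold.maximalAtlas (𝓡 n) 2 M)
    {x : M} (hx : x ∈ c.source) : (mfderiv (𝓡 n) (𝓡 n) c x).IsInvertible :=
  ⟨(mdifferentiable_of_mem_maximalAtlas_two hc).mfderiv hx, rfl⟩

/-- Presenting a field as a pullback from the model space makes the naturality of smoothness and of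
Lie brackets available. -/
theorem mpullback_coordRep (hc : c ∈ IsManifold.maximalAtlas (𝓡 n) 2 M)
    (A : (y : M) → TangentSpace (𝓡 n) y) {x : M} (hx : x ∈ c.source) :
    VectorField.mpullback (𝓡 n) (𝓡 n) c (coordRep c A) x = A x := by
  have h : coordRep c A (c x) = mfderiv (𝓡 n) (𝓡 n) c x (A x) := by
    rw [coordRep, c.left_inv hx]
  exact (congrArg (mfderiv (𝓡 n) (𝓡 n) c x).inverse h).trans
    ((isInvertible_mfderiv_of_mem_maximalAtlas hc hx).inverse_apply_self _)

theorem mpullback_symm_eq_coordRep (hc : c ∈ IsManifold.maximalAtlas (𝓡 n) 2 M)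
    (A : (y : M) → TangentSpace (𝓡 n) y) {u : EuclideanSpace ℝ (Fin n)} (hu : u ∈ c.target) :
    VectorField.mpullback (𝓡 n) (𝓡 n) c.symm A u = coordRep c A u := by
  have h := mdifferentiable_of_mem_maximalAtlas_two hc
  have hinv : (mfderiv (𝓡 n) (𝓡 n) c.symm u).IsInvertible := ⟨h.symm.mfderiv hu, rfl⟩
  refine hinv.inverse_apply_eq.2 ?_
  have := DFunLike.congr_fun (h.symm.comp_symm_deriv (x := c.symm u) (c.map_target hu))
    (A (c.symm u))
  rw [OpenPartialHomeomorph.symm_symm, c.right_inv hu] at this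
  exact this.symm

theorem eventuallyEq_mpullback_coordRep (hc : c ∈ IsManifold.maximalAtlas (𝓡 n) 2 M)
    (A : (y : M) → TangentSpace (𝓡 n) y) {x : M} (hx : x ∈ c.source) :
    A =ᶠ[𝓝 x] VectorField.mpullback (𝓡 n) (𝓡 n) c (coordRep c A) :=
  Filter.eventually_of_mem (c.open_source.mem_nhds hx) fun _ hy => (mpullback_coordRep hc A hy).symm

theorem contMDiffAt_of_contDiffAt_coordRep [IsManifold (𝓡 n) 2 M]
    (hc : c ∈ IsManifold.maximalAtlas (𝓡 n) 2 M)
    {A : (y : M) → TangentSpace (𝓡 n) y} {x : M} (hx : x ∈ c.source)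
    (hA : ContDiffAt ℝ 1 (coordRep c A) (c x)) :
    ContMDiffAt (𝓡 n) (𝓡 n).tangent 1 (fun y => (⟨y, A y⟩ : TangentBundle (𝓡 n) M)) x := by
  have : IsManifold (𝓡 n) 1 M := .of_le one_le_two
  have := (contMDiffAt_vectorSpace_iff_contDiffAt (V := coordRep c A)).2 hA
  refine (this.mpullback_vectorField_preimage (contMDiffAt_of_mem_maximalAtlas hc hx)
    (isInvertible_mfderiv_of_mem_maximalAtlas hc hx) (by norm_num)).congr_of_eventuallyEq ?_
  filter_upwards [eventuallyEq_mpullback_coordRep hc A hx] with y hy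
  rw [hy]

theorem contDiffAt_coordRep [IsManifold (𝓡 n) 2 M]
    (hc : c ∈ IsManifold.maximalAtlas (𝓡 n) 2 M)
    {A : (y : M) → TangentSpace (𝓡 n) y} {x : M} (hx : x ∈ c.source)
    (hA : ContMDiffAt (𝓡 n) (𝓡 n).tangent 1 (fun y => (⟨y, A y⟩ : TangentBundle (𝓡 n) M)) x) :
    ContDiffAt ℝ 1 (coordRep c A) (c x) := by
  have : IsManifold (𝓡 n) 1 M := .of_le one_le_two
  have h := mdifferentiable_of_mem_maximalAtlas_two hc
  have hu := c.map_source hx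
  have hinv : (mfderiv (𝓡 n) (𝓡 n) c.symm (c x)).IsInvertible := ⟨h.symm.mfderiv hu, rfl⟩
  rw [← c.left_inv hx] at hA
  refine (contMDiffAt_vectorSpace_iff_contDiffAt.1 (hA.mpullback_vectorField_preimage
    (contMDiffAt_symm_of_mem_maximalAtlas hc hu) hinv (by norm_num))).congr_of_eventuallyEq ?_
  filter_upwards [c.open_target.mem_nhds hu] with u hu
  exact (mpullback_symm_eq_coordRep hc A hu).symm

/-- Lie brackets are natural under pullback by `c`, and in the model space the manifold bracket is
the usual one. -/
theorem mfderiv_mlieBracket [IsManifold (𝓡 n) 2 M]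
    (hc : c ∈ IsManifold.maximalAtlas (𝓡 n) 2 M)
    {A B : (y : M) → TangentSpace (𝓡 n) y} {x : M} (hx : x ∈ c.source)
    (hA : ContDiffAt ℝ 1 (coordRep c A) (c x)) (hB : ContDiffAt ℝ 1 (coordRep c B) (c x)) :
    mfderiv (𝓡 n) (𝓡 n) c x (VectorField.mlieBracket (𝓡 n) A B x) =
      VectorField.lieBracket ℝ (coordRep c A) (coordRep c B) (c x) := by
  have : IsManifold (𝓡 n) (minSmoothness ℝ 2) M := by simpa
  have hA' := ((contMDiffAt_vectorSpace_iff_contDiffAt (V := coordRep c A)).2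
    hA).mdifferentiableAt one_ne_zero
  have hB' := ((contMDiffAt_vectorSpace_iff_contDiffAt (V := coordRep c B)).2
    hB).mdifferentiableAt one_ne_zero
  have hinv := isInvertible_mfderiv_of_mem_maximalAtlas hc hx
  rw [(eventuallyEq_mpullback_coordRep hc A hx).mlieBracket_vectorField_eq
    (eventuallyEq_mpullback_coordRep hc B hx),
    ← VectorField.mpullback_mlieBracket hA' hB' (contMDiffAt_of_mem_maximalAtlas hc hx) (by simp),
    VectorField.mpullback_apply, hinv.self_apply_inverse]
  exact (congrFun VectorField.mlieBracketWithin_univ _).symm.trans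
    ((congrFun (VectorField.mlieBracketWithin_eq_lieBracketWithin (𝕜 := ℝ)
      (E := EuclideanSpace ℝ (Fin n))
      (V := coordRep c A) (W := coordRep c B)) (c x)).trans
    (congrFun (VectorField.lieBracketWithin_univ (𝕜 := ℝ)
      (E := EuclideanSpace ℝ (Fin n))) (c x)))

end Transports

/-! ### A constant coordinate matrix forces zero torsion. -/

section Transports

variable {n : ℕ} {M : Type*} [TopologicalSpace M] [ChartedSpace (EuclideanSpace ℝ (Fin n)) M]
  {c : OpenPartialHomeomorph M (EuclideanSpace ℝ (Fin n))}

theorem coordRep_apply_self (A : (y : M) → TangentSpace (𝓡 n) y) {x : M} (hx : x ∈ c.source) :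
    coordRep c A (c x) = mfderiv (𝓡 n) (𝓡 n) c x (A x) := by
  rw [coordRep, c.left_inv hx]

theorem mfderiv_coordVec (hc : c ∈ IsManifold.maximalAtlas (𝓡 n) 2 M) {x : M}
    (hx : x ∈ c.source) (i : Fin n) :
    mfderiv (𝓡 n) (𝓡 n) c x (coordVec c x i) = EuclideanSpace.single i (1 : ℝ) :=
  (isInvertible_mfderiv_of_mem_maximalAtlas hc hx).self_apply_inverse _

theorem coordComp_coordVec (hc : c ∈ IsManifold.maximalAtlas (𝓡 n) 2 M) {x : M}
    (hx : x ∈ c.source) (i j : Fin n) :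
    coordComp c x (coordVec c x j) i = (1 : Matrix (Fin n) (Fin n) ℝ) i j := by
  have h := congrArg (fun w : EuclideanSpace ℝ (Fin n) => w i) (mfderiv_coordVec hc hx j)
  refine h.trans ?_
  simp [Matrix.one_apply]

theorem euclidean_linearMap_ext {F : Type*} [AddCommGroup F] [Module ℝ F]
    {f g : EuclideanSpace ℝ (Fin n) →ₗ[ℝ] F}
    (h : ∀ j, f (EuclideanSpace.single j 1) = g (EuclideanSpace.single j 1)) : f = g :=
  (EuclideanSpace.basisFun (Fin n) ℝ).toBasis.ext fun j => by simpa using h j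

/-- In any local coordinates around `x`, the curve `ε ↦ x_ε` has the velocity `v` at `ε = 0`. -/
theorem hasDerivAt_comp_chartLine [IsManifold (𝓡 n) 2 M]
    (hc : c ∈ IsManifold.maximalAtlas (𝓡 n) 2 M) {x : M} (hx : x ∈ c.source)
    (v : TangentSpace (𝓡 n) x) :
    HasDerivAt (fun ε => c (FlatLinearTransport.chartLine v ε))
      (show EuclideanSpace ℝ (Fin n) from mfderiv (𝓡 n) (𝓡 n) c x v) 0 := by
  set c₀ := chartAt (EuclideanSpace ℝ (Fin n)) x with hc₀
  have h₀ := mdifferentiable_of_mem_maximalAtlas_two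
    (IsManifold.chart_mem_maximalAtlas (I := 𝓡 n) (n := 2) x)
  have hx₀ : x ∈ c₀.source := mem_chart_source _ x
  have hcx : HasMFDerivAt (𝓡 n) (𝓡 n) c (c₀.symm (c₀ x)) (mfderiv (𝓡 n) (𝓡 n) c x) := by
    rw [c₀.left_inv hx₀]
    exact ((mdifferentiable_of_mem_maximalAtlas_two hc).mdifferentiableAt hx).hasMFDerivAt
  have hcomp := (hcx.comp (c₀ x)
    (h₀.mdifferentiableAt_symm (c₀.map_source hx₀)).hasMFDerivAt).hasFDerivAt
  set w : EuclideanSpace ℝ (Fin n) := mfderiv (𝓡 n) (𝓡 n) c₀ x v with hw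
  have hline : HasDerivAt (fun ε : ℝ => c₀ x + ε • w) w 0 := by
    simpa using ((hasDerivAt_id (0 : ℝ)).smul_const w).const_add (c₀ x)
  have h := HasFDerivAt.comp_hasDerivAt_of_eq (0 : ℝ) hcomp hline (by simp)
  refine h.congr_deriv ?_
  -- The differentials of `c₀.symm` and `c₀` cancel, so the preferred chart drops out of the
  -- velocity.
  exact congrArg (mfderiv (𝓡 n) (𝓡 n) c x) (DFunLike.congr_fun (h₀.symm_comp_deriv hx₀) v)

namespace FlatLinearTransport

variable (L : FlatLinearTransport n M)

theorem chartLine_zero {x : M} (v : TangentSpace (𝓡 n) x) : chartLine v 0 = x := by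
  rw [chartLine, zero_smul, add_zero]
  exact (chartAt _ x).left_inv (mem_chart_source _ x)

theorem continuousAt_chartLine {x : M} (v : TangentSpace (𝓡 n) x) :
    ContinuousAt (chartLine v) 0 := by
  unfold chartLine
  refine ContinuousAt.comp (g := (chartAt (EuclideanSpace ℝ (Fin n)) x).symm) ?_ (by fun_prop)
  rw [zero_smul, add_zero]
  exact (chartAt _ x).continuousAt_symm (mem_chart_target _ x)

section Constant

variable {L} {C : Matrix (Fin n) (Fin n) ℝ}

/-- If the matrix of the transport in the coordinates `c` is constant, then the transport leaves
the components of vectors unchanged. -/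
theorem mfderiv_vec_of_coordMatrix_eq (hc : c ∈ IsManifold.maximalAtlas (𝓡 n) 2 M)
    (hC : ∀ x ∈ c.source, ∀ y ∈ c.source, L.coordMatrix c c y x = C)
    {x y : M} (hx : x ∈ c.source) (hy : y ∈ c.source) (v : TangentSpace (𝓡 n) x) :
    (mfderiv (𝓡 n) (𝓡 n) c y (L.vec x y v) : EuclideanSpace ℝ (Fin n)) =
      mfderiv (𝓡 n) (𝓡 n) c x v := by
  -- Evaluate the constant matrix on the diagonal, where the transport is the identity.
  have hone : C = 1 := by
    rw [← hC x hx x hx]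
    ext i j
    simp only [coordMatrix, Matrix.of_apply, vec_self]
    exact coordComp_coordVec hc hx i j
  have hxi := isInvertible_mfderiv_of_mem_maximalAtlas hc hx
  let f : EuclideanSpace ℝ (Fin n) →ₗ[ℝ] EuclideanSpace ℝ (Fin n) :=
    (mfderiv (𝓡 n) (𝓡 n) c y).toLinearMap ∘ₗ L.vec x y ∘ₗ
      (mfderiv (𝓡 n) (𝓡 n) c x).inverse.toLinearMap
  have hf : f = LinearMap.id := by
    refine euclidean_linearMap_ext fun j => ?_
    ext i
    have h := congrFun (congrFun (hC x hx y hy) i) j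
    rw [hone] at h
    refine Eq.trans h ?_
    simp [Matrix.one_apply]
  have := DFunLike.congr_fun hf (mfderiv (𝓡 n) (𝓡 n) c x v)
  refine Eq.trans ?_ this
  exact congrArg (fun w => mfderiv (𝓡 n) (𝓡 n) c y (L.vec x y w)) (hxi.inverse_apply_self v).symm

/-- The transport leaves components unchanged, so the quotient defining `∇_v B` is, in components,
the difference quotient of `coordRep c B` along `x_ε`; the chain rule gives its limit. -/
theorem mfderiv_covDerivVec_of_coordMatrix_eq [IsManifold (𝓡 n) 2 M]
    (hc : c ∈ IsManifold.maximalAtlas (𝓡 n) 2 M)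
    (hC : ∀ x ∈ c.source, ∀ y ∈ c.source, L.coordMatrix c c y x = C)
    {x : M} (hx : x ∈ c.source) (v : TangentSpace (𝓡 n) x) {B : (y : M) → TangentSpace (𝓡 n) y}
    (hB : DifferentiableAt ℝ (coordRep c B) (c x)) :
    mfderiv (𝓡 n) (𝓡 n) c x (L.covDerivVec v B) =
      fderiv ℝ (coordRep c B) (c x) (mfderiv (𝓡 n) (𝓡 n) c x v) := by
  have hxi := isInvertible_mfderiv_of_mem_maximalAtlas hc hx
  have hcov : L.covDerivVec v B = (mfderiv (𝓡 n) (𝓡 n) c x).inverse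
      (fderiv ℝ (coordRep c B) (c x) (mfderiv (𝓡 n) (𝓡 n) c x v)) := by
    refine L.covDerivVec_eq_of_tendsto ?_
    have hB' : HasFDerivAt (coordRep c B) (fderiv ℝ (coordRep c B) (c x))
        (c (chartLine v 0)) := by
      rw [chartLine_zero]
      exact hB.hasFDerivAt
    have h1 := (hB'.comp_hasDerivAt (0 : ℝ) (hasDerivAt_comp_chartLine hc hx v)).tendsto_slope_zero
    refine (((mfderiv (𝓡 n) (𝓡 n) c x).inverse.continuous.tendsto _).comp h1).congr' ?_
    have hev : ∀ᶠ ε in 𝓝 (0 : ℝ), chartLine v ε ∈ c.source :=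
      (continuousAt_chartLine v).eventually_mem
        (c.open_source.mem_nhds (by rwa [chartLine_zero]))
    filter_upwards [hev.filter_mono nhdsWithin_le_nhds] with ε hε
    refine hxi.inverse_apply_eq.2 ?_
    simp only [Function.comp_apply, zero_add, chartLine_zero]
    rw [map_smul, map_sub]
    exact congrArg₂ (fun a b : EuclideanSpace ℝ (Fin n) => ε⁻¹ • (a - b))
      ((coordRep_apply_self _ hε).trans (mfderiv_vec_of_coordMatrix_eq hc hC hε hx _).symm)
      (coordRep_apply_self _ hx)
  rw [hcov]
  exact hxi.self_apply_inverse _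

/-- In components, `∇_A B - ∇_B A` is `DB(A) - DA(B)`, which is exactly the bracket. -/
theorem torsion_eq_zero_of_coordMatrix_eq [IsManifold (𝓡 n) 2 M]
    (hc : c ∈ IsManifold.maximalAtlas (𝓡 n) 2 M)
    (hC : ∀ x ∈ c.source, ∀ y ∈ c.source, L.coordMatrix c c y x = C)
    {x : M} (hx : x ∈ c.source) {A B : (y : M) → TangentSpace (𝓡 n) y}
    (hA : ContMDiffAt (𝓡 n) (𝓡 n).tangent 1 (fun y => (⟨y, A y⟩ : TangentBundle (𝓡 n) M)) x)
    (hB : ContMDiffAt (𝓡 n) (𝓡 n).tangent 1 (fun y => (⟨y, B y⟩ : TangentBundle (𝓡 n) M)) x) :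
    L.torsion A B x = 0 := by
  have hA' := contDiffAt_coordRep hc hx hA
  have hB' := contDiffAt_coordRep hc hx hB
  refine (isInvertible_mfderiv_of_mem_maximalAtlas hc hx).injective ?_
  have h1 := mfderiv_covDerivVec_of_coordMatrix_eq hc hC hx (A x)
    (hB'.differentiableAt one_ne_zero)
  have h2 := mfderiv_covDerivVec_of_coordMatrix_eq hc hC hx (B x)
    (hA'.differentiableAt one_ne_zero)
  rw [torsion, map_sub, map_sub, map_zero, h1, h2, mfderiv_mlieBracket hc hx hA' hB',
    VectorField.lieBracket, coordRep_apply_self A hx, coordRep_apply_self B hx]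
  exact sub_self _

end Constant

end FlatLinearTransport

end Transports

/-! ### Zero torsion makes the transported frame holonomic. -/

section Transports

variable {n : ℕ} {M : Type*} [TopologicalSpace M] [ChartedSpace (EuclideanSpace ℝ (Fin n)) M]
  {c : OpenPartialHomeomorph M (EuclideanSpace ℝ (Fin n))}

namespace FlatLinearTransport

variable (L : FlatLinearTransport n M)

/-- The frame of vector fields obtained by transporting vectors from `x₀`, represented in the
local coordinates `c`. -/
def frameRep (x₀ : M) (c : OpenPartialHomeomorph M (EuclideanSpace ℝ (Fin n)))
    (u : EuclideanSpace ℝ (Fin n)) : EuclideanSpace ℝ (Fin n) →L[ℝ] EuclideanSpace ℝ (Fin n) :=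
  LinearMap.toContinuousLinearMap (E := EuclideanSpace ℝ (Fin n)) (F' := EuclideanSpace ℝ (Fin n))
    ((mfderiv (𝓡 n) (𝓡 n) c (c.symm u)).toLinearMap ∘ₗ L.vec x₀ (c.symm u))

theorem frameRep_apply_chart (x₀ : M) {y : M} (hy : y ∈ c.source) (v : TangentSpace (𝓡 n) x₀) :
    L.frameRep x₀ c (c y) v = mfderiv (𝓡 n) (𝓡 n) c y (L.vec x₀ y v) :=
  coordRep_apply_self (fun y => L.vec x₀ y v) hy

theorem isInvertible_frameRep (hc : c ∈ IsManifold.maximalAtlas (𝓡 n) 2 M) (x₀ : M)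
    {u : EuclideanSpace ℝ (Fin n)} (hu : u ∈ c.target) : (L.frameRep x₀ c u).IsInvertible := by
  let e : EuclideanSpace ℝ (Fin n) ≃ₗ[ℝ] EuclideanSpace ℝ (Fin n) :=
    (L.vecEquiv x₀ (c.symm u)).trans
      ((mdifferentiable_of_mem_maximalAtlas_two hc).mfderiv (c.map_target hu)).toLinearEquiv
  exact ⟨e.toContinuousLinearEquiv, rfl⟩

variable {L}

/-- With the source point frozen at `x₀`, the columns of the frame are columns of `H(y, x₀)`, which
are `C¹` in `y`. -/
theorem contDiffOn_frameRep [IsManifold (𝓡 n) 2 M] (hL : L.IsC1)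
    (hc : c ∈ IsManifold.maximalAtlas (𝓡 n) 2 M) (x₀ : M) :
    ContDiffOn ℝ 1 (L.frameRep x₀ c) c.target := by
  set c₀ := chartAt (EuclideanSpace ℝ (Fin n)) x₀
  have hc₀ : c₀ ∈ IsManifold.maximalAtlas (𝓡 n) 2 M := IsManifold.chart_mem_maximalAtlas x₀
  have hx₀ : x₀ ∈ c₀.source := mem_chart_source _ x₀
  have hinv := isInvertible_mfderiv_of_mem_maximalAtlas hc₀ hx₀
  have hcoord : ∀ j, ContDiffOn ℝ 1 (fun u => L.frameRep x₀ c u (coordVec c₀ x₀ j)) c.target := by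
    intro j
    rw [contDiffOn_euclidean]
    intro i
    rw [← contMDiffOn_iff_contDiffOn]
    have hsymm : ContMDiffOn (𝓡 n) (𝓡 n) 1 c.symm c.target :=
      (contMDiffOn_symm_of_mem_maximalAtlas hc).of_le one_le_two
    exact (hL c₀ hc₀ c hc i j).comp (hsymm.prodMk contMDiffOn_const)
      fun u hu => ⟨c.map_target hu, hx₀⟩
  rw [contDiffOn_clm_apply]
  intro v
  -- `IsC1` controls the images of the coordinate vectors of `c₀` only; a general vector is a
  -- constant combination of them.
  have hv : v = ∑ j, (show EuclideanSpace ℝ (Fin n) from mfderiv (𝓡 n) (𝓡 n) c₀ x₀ v) j •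
      (show EuclideanSpace ℝ (Fin n) from coordVec c₀ x₀ j) := by
    let f : EuclideanSpace ℝ (Fin n) →ₗ[ℝ] EuclideanSpace ℝ (Fin n) :=
      (mfderiv (𝓡 n) (𝓡 n) c₀ x₀).inverse.toLinearMap
    set w : EuclideanSpace ℝ (Fin n) := mfderiv (𝓡 n) (𝓡 n) c₀ x₀ v
    have h1 : v = f w := (hinv.inverse_apply_self v).symm
    have h2 : w = ∑ j, w j • EuclideanSpace.single j (1 : ℝ) := by
      simpa using ((EuclideanSpace.basisFun (Fin n) ℝ).sum_repr w).symm
    rw [h1]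
    conv_lhs => rw [h2, map_sum]
    simp only [map_smul]
    rfl
  rw [hv]
  simp only [map_sum]
  exact ContDiffOn.sum fun j _ => ((hcoord j).const_smul _).congr fun u _ =>
    (L.frameRep x₀ c u).map_smul _ _

/-- This regularity admits transported fields as arguments in `TorsionVanishes`. -/
theorem contMDiffAt_vec [IsManifold (𝓡 n) 2 M] (hL : L.IsC1) (x₀ : M)
    (v : TangentSpace (𝓡 n) x₀) (x : M) :
    ContMDiffAt (𝓡 n) (𝓡 n).tangent 1
      (fun y => (⟨y, L.vec x₀ y v⟩ : TangentBundle (𝓡 n) M)) x := by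
  set c := chartAt (EuclideanSpace ℝ (Fin n)) x
  have hc : c ∈ IsManifold.maximalAtlas (𝓡 n) 2 M := IsManifold.chart_mem_maximalAtlas x
  have hx : x ∈ c.source := mem_chart_source _ x
  refine contMDiffAt_of_contDiffAt_coordRep hc hx ?_
  exact ((contDiffOn_frameRep hL hc x₀).contDiffAt
    (c.open_target.mem_nhds (c.map_source hx))).clm_apply
    (contDiffAt_const (F := EuclideanSpace ℝ (Fin n)) (c := v))

/-- If the torsion vanishes, then the vector fields which the transport preserves commute. -/
theorem mlieBracket_vec_eq_zero [IsManifold (𝓡 n) 2 M] (hL : L.IsC1) (hT : L.TorsionVanishes)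
    (x₀ : M) (v w : TangentSpace (𝓡 n) x₀) (x : M) :
    VectorField.mlieBracket (𝓡 n) (fun y => L.vec x₀ y v) (fun y => L.vec x₀ y w) x = 0 := by
  have htor := hT _ _ x (contMDiffAt_vec hL x₀ v x) (contMDiffAt_vec hL x₀ w x)
  rwa [torsion, covDerivVec_vec, covDerivVec_vec, sub_zero, zero_sub, neg_eq_zero] at htor

/-- The two sides differ by the coordinate expression of the bracket of two transported fields,
which is zero. -/
theorem fderiv_frameRep_symmetric [IsManifold (𝓡 n) 2 M] (hL : L.IsC1) (hT : L.TorsionVanishes)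
    (hc : c ∈ IsManifold.maximalAtlas (𝓡 n) 2 M) (x₀ : M) {u : EuclideanSpace ℝ (Fin n)}
    (hu : u ∈ c.target) (v w : EuclideanSpace ℝ (Fin n)) :
    fderiv ℝ (L.frameRep x₀ c) u (L.frameRep x₀ c u v) w =
      fderiv ℝ (L.frameRep x₀ c) u (L.frameRep x₀ c u w) v := by
  have hF : ContDiffAt ℝ 1 (L.frameRep x₀ c) u :=
    (contDiffOn_frameRep hL hc x₀).contDiffAt (c.open_target.mem_nhds hu)
  have hv : ∀ v : EuclideanSpace ℝ (Fin n), ContDiffAt ℝ 1 (fun y => L.frameRep x₀ c y v) u :=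
    fun v => hF.clm_apply contDiffAt_const
  have hderiv : ∀ v h : EuclideanSpace ℝ (Fin n),
      fderiv ℝ (fun y => L.frameRep x₀ c y v) u h = fderiv ℝ (L.frameRep x₀ c) u h v := by
    intro v h
    rw [((hF.differentiableAt one_ne_zero).hasFDerivAt.clm_apply (hasFDerivAt_const v u)).fderiv]
    simp
  have hbr := mfderiv_mlieBracket (A := fun y => L.vec x₀ y v) (B := fun y => L.vec x₀ y w) hc
    (c.map_target hu) (by rw [c.right_inv hu]; exact hv v) (by rw [c.right_inv hu]; exact hv w)
  rw [mlieBracket_vec_eq_zero hL hT x₀ v w, map_zero, c.right_inv hu] at hbr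
  have h := sub_eq_zero.1 hbr.symm
  rw [← hderiv, ← hderiv]
  exact h

/-- If the torsion vanishes, then the transported bases are locally holonomic. -/
theorem exists_coordVec_eq_vec [IsManifold (𝓡 n) 2 M] (hL : L.IsC1) (hT : L.TorsionVanishes)
    (x₀ z : M) :
    ∃ d ∈ IsManifold.maximalAtlas (𝓡 n) 2 M, z ∈ d.source ∧ ∀ y ∈ d.source, ∀ i,
      L.vec x₀ y (EuclideanSpace.single i (1 : ℝ) : EuclideanSpace ℝ (Fin n)) = coordVec d y i := by
  set c := chartAt (EuclideanSpace ℝ (Fin n)) z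
  have hc : c ∈ IsManifold.maximalAtlas (𝓡 n) 2 M := IsManifold.chart_mem_maximalAtlas z
  have hz : z ∈ c.source := mem_chart_source _ z
  obtain ⟨φ, hzφ, hφc, hφ, hφs, hφd⟩ := exists_openPartialHomeomorph_hasFDerivAt_inverse
    c.open_target (contDiffOn_frameRep hL hc x₀) (fun u hu => L.isInvertible_frameRep hc x₀ hu)
    (fun u hu v w => fderiv_frameRep_symmetric hL hT hc x₀ hu v w) (c.map_source hz)
  have hd : c.trans φ ∈ IsManifold.maximalAtlas (𝓡 n) 2 M := by
    refine OpenPartialHomeomorph.mem_maximalAtlas_of_contMDiffOn _ ?_ ?_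
    · exact hφ.contMDiffOn.comp ((contMDiffOn_of_mem_maximalAtlas hc).mono fun y hy => hy.1)
        fun y hy => hy.2
    · exact (contMDiffOn_symm_of_mem_maximalAtlas hc).comp
        (hφs.contMDiffOn.mono fun y hy => hy.1) fun y hy => hy.2
  refine ⟨c.trans φ, hd, ⟨hz, hzφ⟩, fun y hy i => ?_⟩
  have hyc : y ∈ c.source := hy.1
  have hinv := isInvertible_mfderiv_of_mem_maximalAtlas hd hy
  -- In the new coordinates the differential is `A⁻¹ ∘ Dc`, while `A` is `Dc ∘ L_{x₀ → y}`; hence it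
  -- sends each transported basis vector to a standard one.
  have hderiv : HasMFDerivAt (𝓡 n) (𝓡 n) (c.trans φ) y
      ((L.frameRep x₀ c (c y)).inverse ∘L mfderiv (𝓡 n) (𝓡 n) c y) :=
    HasMFDerivAt.comp (f := c) y (hφd (c y) hy.2).hasMFDerivAt
      ((mdifferentiable_of_mem_maximalAtlas_two hc).mdifferentiableAt hyc).hasMFDerivAt
  refine (hinv.inverse_apply_eq.2 ?_).symm
  rw [hderiv.mfderiv]
  have h := (L.isInvertible_frameRep hc x₀ (c.map_source hyc)).inverse_apply_self
    (EuclideanSpace.single i (1 : ℝ))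
  exact h.symm.trans <| congrArg (L.frameRep x₀ c (c y)).inverse (L.frameRep_apply_chart x₀ hyc _)

/-- The field of bases obtained by transporting the standard basis of `T_{x₀}(M)`. -/
def transportedBasis (L : FlatLinearTransport n M) (x₀ x : M) :
    Module.Basis (Fin n) ℝ (TangentSpace (𝓡 n) x) :=
  (show Module.Basis (Fin n) ℝ (TangentSpace (𝓡 n) x₀) from
    (EuclideanSpace.basisFun (Fin n) ℝ).toBasis).map (L.vecEquiv x₀ x)

theorem transportedBasis_apply (L : FlatLinearTransport n M) (x₀ x : M) (i : Fin n) :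
    L.transportedBasis x₀ x i =
      L.vec x₀ x (EuclideanSpace.single i (1 : ℝ) : EuclideanSpace ℝ (Fin n)) := by
  have h : (EuclideanSpace.basisFun (Fin n) ℝ).toBasis i = EuclideanSpace.single i (1 : ℝ) := by
    simp
  exact congrArg (fun w : EuclideanSpace ℝ (Fin n) => L.vec x₀ x w) h

theorem matrix_transportedBasis (L : FlatLinearTransport n M) (x₀ x y : M) :
    L.matrix (L.transportedBasis x₀) y x = 1 := by
  ext i j
  have h : L.vec x y (L.transportedBasis x₀ x j) = L.transportedBasis x₀ y j :=
    ((congrArg (L.vec x y) (L.transportedBasis_apply x₀ x j)).trans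
      (L.vec_comp x₀ x y _)).trans (L.transportedBasis_apply x₀ y j).symm
  rw [matrix, LinearMap.toMatrix_apply, h, Module.Basis.repr_self, Matrix.one_apply, Finsupp.single_apply]
  simp only [eq_comm]

theorem exists_isHolonomic_matrix_eq [IsManifold (𝓡 n) 2 M] (hL : L.IsC1)
    (hT : L.TorsionVanishes) :
    ∃ E : (x : M) → Module.Basis (Fin n) ℝ (TangentSpace (𝓡 n) x), IsHolonomic E ∧
      ∃ C : Matrix (Fin n) (Fin n) ℝ, ∀ x y : M, L.matrix E y x = C := by
  rcases isEmpty_or_nonempty M with _ | ⟨⟨x₀⟩⟩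
  -- An empty manifold has no base point, and any matrix serves.
  · exact ⟨fun x => isEmptyElim x, fun x => isEmptyElim x, 1, fun x => isEmptyElim x⟩
  refine ⟨L.transportedBasis x₀, fun z => ?_, 1, fun x y => L.matrix_transportedBasis x₀ x y⟩
  obtain ⟨d, hd, hz, h⟩ := exists_coordVec_eq_vec hL hT x₀ z
  exact ⟨d, hd, hz, fun y hy i => (L.transportedBasis_apply x₀ y i).trans (h y hy i)⟩

/-- The functionals `coordComp c y` form the dual basis of `coordVec c y`; this passes from a global
holonomic field to local coordinates. -/
theorem coordMatrix_eq_matrix {E : (x : M) → Module.Basis (Fin n) ℝ (TangentSpace (𝓡 n) x)}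
    (hc : c ∈ IsManifold.maximalAtlas (𝓡 n) 2 M)
    (hE : ∀ y ∈ c.source, ∀ i, E y i = coordVec c y i) {x y : M} (hx : x ∈ c.source)
    (hy : y ∈ c.source) : L.coordMatrix c c y x = L.matrix E y x := by
  ext i j
  have hcomp : ∀ w, coordComp c y w i = (E y).repr w i := by
    intro w
    let f : TangentSpace (𝓡 n) y →ₗ[ℝ] ℝ :=
      (EuclideanSpace.proj  i : EuclideanSpace ℝ (Fin n) →L[ℝ] ℝ).toLinearMap ∘ₗ
        (mfderiv (𝓡 n) (𝓡 n) c y).toLinearMap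
    have hf : f = (E y).coord i := (E y).ext fun k => by
      refine Eq.trans (congrArg f (hE y hy k)) ((coordComp_coordVec hc hy i k).trans ?_)
      rw [Module.Basis.coord_apply, Module.Basis.repr_self, Matrix.one_apply, Finsupp.single_apply]
      simp only [eq_comm]
    exact DFunLike.congr_fun hf w
  rw [matrix, LinearMap.toMatrix_apply, hE x hx, ← hcomp]
  rfl

end FlatLinearTransport

end Transports

/-! ### The cycle of implications (a) ⇒ (b) ⇒ (c) ⇒ (a). -/

theorem corollary4p1 {n : ℕ} {M : Type*} [TopologicalSpace M]
    [ChartedSpace (EuclideanSpace ℝ (Fin n)) M] [IsManifold (𝓡 n) 2 M]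
    (L : FlatLinearTransport n M) (hL : L.IsC1) :
    -- one holonomic field of bases on all of `M`, the matrix being constant on `M × M`
    (L.TorsionVanishes ↔
      ∃ E : (x : M) → Module.Basis (Fin n) ℝ (TangentSpace (𝓡 n) x), IsHolonomic E ∧
        ∃ C : Matrix (Fin n) (Fin n) ℝ, ∀ x y : M, L.matrix E y x = C) ∧
    -- a holonomic basis around each point, the matrix being constant near that point
    (L.TorsionVanishes ↔
      ∀ z : M, ∃ c ∈ IsManifold.maximalAtlas (𝓡 n) 2 M, z ∈ c.source ∧
        ∃ C : Matrix (Fin n) (Fin n) ℝ,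
          ∀ x ∈ c.source, ∀ y ∈ c.source, L.coordMatrix c c y x = C) := by
  have hab := fun hT : L.TorsionVanishes => L.exists_isHolonomic_matrix_eq hL hT
  have hbc : (∃ E : (x : M) → Module.Basis (Fin n) ℝ (TangentSpace (𝓡 n) x), IsHolonomic E ∧
      ∃ C : Matrix (Fin n) (Fin n) ℝ, ∀ x y : M, L.matrix E y x = C) →
      ∀ z : M, ∃ c ∈ IsManifold.maximalAtlas (𝓡 n) 2 M, z ∈ c.source ∧
        ∃ C : Matrix (Fin n) (Fin n) ℝ,
          ∀ x ∈ c.source, ∀ y ∈ c.source, L.coordMatrix c c y x = C := by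
    rintro ⟨E, hE, C, hC⟩ z
    obtain ⟨c, hc, hz, hEc⟩ := hE z
    exact ⟨c, hc, hz, C, fun x hx y hy =>
      (FlatLinearTransport.coordMatrix_eq_matrix hc hEc hx hy).trans (hC x y)⟩
  have hca : (∀ z : M, ∃ c ∈ IsManifold.maximalAtlas (𝓡 n) 2 M, z ∈ c.source ∧
        ∃ C : Matrix (Fin n) (Fin n) ℝ,
          ∀ x ∈ c.source, ∀ y ∈ c.source, L.coordMatrix c c y x = C) → L.TorsionVanishes := by
    intro h A B x hA hB
    obtain ⟨c, hc, hx, C, hC⟩ := h x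
    exact FlatLinearTransport.torsion_eq_zero_of_coordMatrix_eq hc hC hx hA hB
  exact ⟨⟨hab, fun h => hca (hbc h)⟩, ⟨fun h => hbc (hab h), hca⟩⟩

end
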